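/- Let $\alpha_1,\alpha_2,\alpha_3>0$, let $C,D$ be real with $-1<D<C\le 1$, and let $m,k$ be real constants with $k\ge m\ge 2$ such that $$(\alpha_1-\alpha_2-m^2\alpha_3-3m(k-1)\alpha_3)(1-D^2)\ \ge\ e\,(1+|D|)(C-D).$$ Let $p$ be analytic in the open unit disk $\mathbb{D}$ with $p(0)=1$. If $$1+\alpha_1 zp'(z)+\alpha_2 z^2p''(z)+\alpha_3 z^3p'''(z)\ \prec\ \frac{1+Cz}{1+Dz},$$ then $p(z)\prec e^z$. Here $f\prec g$ (subordination) means that there is an analytic function $w:\mathbb{D}\to\mathbb{D}$ with $w(0)=0$ and $|w(z)|\le|z|$ such that $f(z)=g(w(z))$ for all $z\in\mathbb{D}$. -/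

import Mathlib

/-- A Schwarz function: analytic in the open unit disk, `w 0 = 0` and `‖w z‖ ≤ ‖z‖` there. -/
def IsSchwarzFunction (w : ℂ → ℂ) : Prop :=
  AnalyticOnNhd ℂ w (Metric.ball 0 1) ∧ w 0 = 0 ∧ ∀ z ∈ Metric.ball (0 : ℂ) 1, ‖w z‖ ≤ ‖z‖

/-- Subordination `f ≺ g` in the open unit disk: `f = g ∘ w` there for a Schwarz function `w`. -/
def Subordinate (f g : ℂ → ℂ) : Prop :=
  ∃ w : ℂ → ℂ, IsSchwarzFunction w ∧ ∀ z ∈ Metric.ball (0 : ℂ) 1, f z = g (w z)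

/-! Write `p = ∑ aₙ zⁿ`. The differential expression minus `1` has coefficients `lₙ aₙ` with `lₙ ≥
α₁ n`, and subordination bounds it by `M = (C - D) / (1 - |D|)`. The hypothesis on the constants
gives `e M ≤ α₁`, so Bessel yields `∑ (n ‖aₙ‖)² ≤ (M / α₁)² ≤ e⁻²`. Cauchy–Schwarz against `∑ n⁻² ≤
2` then gives `‖p - 1‖ ≤ √2 / e < 0.53`. This is small enough that the principal `log p` is analytic
and maps the disk into the closed unit disk; by the Schwarz lemma it is the required Schwarz
function. -/

open Filter Topology in
/-- Bessel's inequality for the Taylor coefficients of a bounded function on the unit disk. -/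
theorem sum_norm_sq_coeff_le_of_norm_le {c : ℕ → ℂ} {h : ℂ → ℂ} {M : ℝ}
    (hc : ∀ z ∈ Metric.ball (0 : ℂ) 1, HasSum (fun n => c n * z ^ n) (h z))
    (hM : ∀ z ∈ Metric.ball (0 : ℂ) 1, ‖h z‖ ≤ M) (s : Finset ℕ) :
    ∑ n ∈ s, ‖c n‖ ^ 2 ≤ M ^ 2 := by
  have hM0 : 0 ≤ M := (norm_nonneg _).trans (hM 0 (by simp))
  -- On the circle of radius `r < 1` the series converges uniformly, so its Fourier coefficients are
  -- `c n * r ^ n`; afterwards `r → 1`.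
  have key : ∀ r : ℝ, 0 ≤ r → r < 1 → ∑ n ∈ s, ‖c n * (r : ℂ) ^ n‖ ^ 2 ≤ M ^ 2 := by
    intro r hr0 hr1
    have hball : ∀ x : UnitAddCircle, (r : ℂ) * fourier 1 x ∈ Metric.ball (0 : ℂ) 1 := by
      intro x
      rw [mem_ball_zero_iff, norm_mul, fourier_one, Circle.norm_coe, Complex.norm_real,
        Real.norm_of_nonneg hr0, mul_one]
      exact hr1
    have hsumm : Summable (fun n : ℕ => (c n * (r : ℂ) ^ n) •
        (fourier (n : ℤ) : C(UnitAddCircle, ℂ))) := by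
      apply Summable.of_norm
      simp only [norm_smul, fourier_norm, mul_one]
      refine (hc r ?_).summable.norm
      simpa [abs_of_nonneg hr0] using hr1
    obtain ⟨F, hF⟩ := hsumm
    have hFx : ∀ x, F x = h (r * fourier 1 x) := by
      intro x
      have h1 := hF.map (ContinuousMap.evalCLM ℂ x : C(UnitAddCircle, ℂ) →L[ℂ] ℂ)
        (ContinuousLinearMap.continuous _)
      refine h1.unique ?_
      convert hc _ (hball x) using 2 with n
      simp [fourier_apply, mul_pow, mul_assoc, AddCircle.toCircle_nsmul]
    have hFM : ‖F‖ ≤ M := by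
      rw [ContinuousMap.norm_le _ hM0]
      intro x
      rw [hFx]
      exact hM _ (hball x)
    let L := ContinuousMap.toLp (E := ℂ) 2 (AddCircle.haarAddCircle (T := (1 : ℝ))) ℂ
    have hLF : ‖L F‖ ≤ M := by
      refine (L.le_opNorm F).trans ?_
      have hL : ‖L‖ ≤ 1 := by
        refine (ContinuousMap.toLp_norm_le (𝕜 := ℂ)
          (μ := AddCircle.haarAddCircle (T := (1 : ℝ))) (p := 2)).trans ?_
        simp [MeasureTheory.measureUnivNNReal]
      nlinarith [norm_nonneg F, norm_nonneg L]
    have hon : Orthonormal ℂ (fun n : ℕ => fourierLp (T := (1 : ℝ)) 2 (n : ℤ)) :=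
      orthonormal_fourier.comp _ Nat.cast_injective
    have hinner : ∀ n : ℕ, inner ℂ (fourierLp (T := (1 : ℝ)) 2 (n : ℤ)) (L F)
        = c n * (r : ℂ) ^ n := by
      intro n
      have h1 := (hF.map L L.continuous).map
        (innerSL ℂ (fourierLp (T := (1 : ℝ)) 2 (n : ℤ))) (ContinuousLinearMap.continuous _)
      refine h1.unique ?_
      have hterm : ∀ m : ℕ, ((innerSL ℂ (fourierLp (T := (1 : ℝ)) 2 (n : ℤ))) ∘
          (L ∘ fun n : ℕ => (c n * (r : ℂ) ^ n) • (fourier (n : ℤ) : C(UnitAddCircle, ℂ)))) m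
          = if n = m then c m * (r : ℂ) ^ m else 0 := by
        intro m
        have h2 := orthonormal_iff_ite.mp hon n m
        change inner ℂ (fourierLp (T := (1 : ℝ)) 2 (n : ℤ)) (L (_ • fourier (m : ℤ))) = _
        rw [map_smul, inner_smul_right]
        change _ * inner ℂ (fourierLp (T := (1 : ℝ)) 2 (n : ℤ))
          (fourierLp (T := (1 : ℝ)) 2 (m : ℤ)) = _
        rw [h2]
        simp
      have h3 := hasSum_single (f := (innerSL ℂ (fourierLp (T := (1 : ℝ)) 2 (n : ℤ))) ∘
          (L ∘ fun n : ℕ => (c n * (r : ℂ) ^ n) • (fourier (n : ℤ) : C(UnitAddCircle, ℂ)))) n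
          (fun m hm => by rw [hterm, if_neg (Ne.symm hm)])
      rwa [hterm n, if_pos rfl] at h3
    have hB := hon.sum_inner_products_le (x := L F) (s := s)
    simp only [hinner] at hB
    exact hB.trans (by gcongr)
  have hcont : Continuous fun r : ℝ => ∑ n ∈ s, ‖c n * (r : ℂ) ^ n‖ ^ 2 := by fun_prop
  have hlim : Tendsto (fun r : ℝ => ∑ n ∈ s, ‖c n * (r : ℂ) ^ n‖ ^ 2) (𝓝[<] 1)
      (𝓝 (∑ n ∈ s, ‖c n‖ ^ 2)) := by
    have := (hcont.tendsto 1).mono_left (nhdsWithin_le_nhds (s := Set.Iio 1))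
    simpa using this
  refine le_of_tendsto hlim ?_
  filter_upwards [Ioo_mem_nhdsLT (zero_lt_one (α := ℝ))] with r hr
  exact key r hr.1.le hr.2

/-- The Taylor expansion of `z ^ j * p⁽ʲ⁾ z` on the unit disk. -/
theorem hasSum_pow_mul_iteratedDeriv {p : ℂ → ℂ} (hp : AnalyticOnNhd ℂ p (Metric.ball 0 1))
    (j : ℕ) {z : ℂ} (hz : z ∈ Metric.ball (0 : ℂ) 1) :
    HasSum (fun n : ℕ => (n.descFactorial j : ℂ) * (iteratedDeriv n p 0 / n.factorial) * z ^ n)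
      (z ^ j * iteratedDeriv j p z) := by
  have hd : DifferentiableOn ℂ (iteratedDeriv j p) (Metric.ball 0 1) := by
    rw [iteratedDeriv_eq_iterate]
    exact (hp.iterated_deriv j).differentiableOn
  have h1 := (Complex.hasSum_taylorSeries_on_ball hd hz).mul_left (z ^ j)
  have h0 : ∀ n < j, (n.descFactorial j : ℂ) * (iteratedDeriv n p 0 / n.factorial) * z ^ n = 0 := by
    intro n hn
    simp [Nat.descFactorial_of_lt hn]
  rw [← hasSum_nat_add_iff' j, Finset.sum_eq_zero fun n hn => h0 n (Finset.mem_range.mp hn),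
    sub_zero]
  convert! h1 using 1
  funext n
  have hfac : (n.factorial : ℂ) * ((n + j).descFactorial j : ℂ) = (n + j).factorial := by
    have := Nat.factorial_mul_descFactorial (Nat.le_add_left j n)
    rw [Nat.add_sub_cancel] at this
    exact_mod_cast this
  have hit : iteratedDeriv n (iteratedDeriv j p) 0 = iteratedDeriv (n + j) p 0 := by
    simp only [iteratedDeriv_eq_iterate, Function.iterate_add_apply]
  have hn : (n.factorial : ℂ) ≠ 0 := Nat.cast_ne_zero.mpr n.factorial_ne_zero
  have hd : ((n + j).descFactorial j : ℂ) ≠ 0 :=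
    right_ne_zero_of_mul (hfac ▸ Nat.cast_ne_zero.mpr (n + j).factorial_ne_zero)
  rw [hit, ← hfac, sub_zero, smul_eq_mul, smul_eq_mul, pow_add]
  field_simp

/-- An analytic function on the disk with `p 0 = 1` and `‖p - 1‖ ≤ 53 / 100` is subordinate
to the exponential. -/
theorem subordinate_exp_of_norm_sub_one_le {p : ℂ → ℂ}
    (hp : AnalyticOnNhd ℂ p (Metric.ball 0 1)) (hp0 : p 0 = 1)
    (hb : ∀ z ∈ Metric.ball (0 : ℂ) 1, ‖p z - 1‖ ≤ 53 / 100) : Subordinate p Complex.exp := by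
  have hslit : ∀ z ∈ Metric.ball (0 : ℂ) 1, p z ∈ Complex.slitPlane := by
    intro z hz
    have := Complex.mem_slitPlane_of_norm_lt_one (z := p z - 1) (by linarith [hb z hz])
    simpa using this
  have han : AnalyticOnNhd ℂ (fun z => Complex.log (p z)) (Metric.ball 0 1) :=
    fun z hz => (hp z hz).clog (hslit z hz)
  refine ⟨fun z => Complex.log (p z), ⟨han, by simp [hp0], ?_⟩, fun z hz => ?_⟩
  · intro z hz
    refine Complex.norm_le_norm_of_mapsTo_ball han.differentiableOn ?_ (by simp [hp0])
      (mem_ball_zero_iff.mp hz)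
    intro y hy
    rw [mem_closedBall_zero_iff]
    have hu := hb y hy
    have h1 := Complex.norm_log_one_add_le (z := p y - 1) (by linarith)
    rw [add_sub_cancel] at h1
    refine h1.trans ?_
    have h0 := norm_nonneg (p y - 1)
    have h2 : (1 - ‖p y - 1‖)⁻¹ ≤ 100 / 47 := by
      rw [inv_le_comm₀ (by linarith) (by norm_num)]
      linarith
    -- With `u = ‖p y - 1‖`, `‖log (p y)‖ ≤ u + u² / (2 (1 - u)) < 0.83` when `u ≤ 0.53`.
    have h3 : ‖p y - 1‖ ^ 2 * (1 - ‖p y - 1‖)⁻¹ ≤ (53 / 100) ^ 2 * (100 / 47) := by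
      have : 0 ≤ (1 - ‖p y - 1‖)⁻¹ := inv_nonneg.mpr (by linarith)
      gcongr
    linarith
  · exact (Complex.exp_log (Complex.slitPlane_ne_zero (hslit z hz))).symm

/-- The image of the disk under `z ↦ (1 + C z) / (1 + D z)` lies within `(C - D) / (1 - |D|)`
of `1`. -/
theorem norm_janowski_sub_one_le {C D : ℝ} (hD : |D| < 1) (hDC : D < C) {w : ℂ} (hw : ‖w‖ ≤ 1) :
    ‖(1 + (C : ℂ) * w) / (1 + (D : ℂ) * w) - 1‖ ≤ (C - D) / (1 - |D|) := by
  have h1 : 1 - |D| ≤ ‖1 + (D : ℂ) * w‖ := by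
    have h2 := norm_sub_norm_le (1 : ℂ) (-((D : ℂ) * w))
    rw [sub_neg_eq_add, norm_neg, norm_mul, Complex.norm_real, norm_one, Real.norm_eq_abs] at h2
    nlinarith [abs_nonneg D]
  have h3 : 1 + (D : ℂ) * w ≠ 0 := norm_pos_iff.mp (by linarith)
  rw [div_sub_one h3, norm_div]
  have h4 : ‖1 + (C : ℂ) * w - (1 + (D : ℂ) * w)‖ ≤ C - D := by
    have : 1 + (C : ℂ) * w - (1 + (D : ℂ) * w) = ((C - D : ℝ) : ℂ) * w := by push_cast; ring
    rw [this, norm_mul, Complex.norm_real, Real.norm_of_nonneg (by linarith)]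
    nlinarith
  exact div_le_div₀ (by linarith) h4 (by linarith) h1

/-- If `∑ (n ‖a n‖)² ≤ K²` for every finite sum, then `∑ ‖a n‖ ≤ √2 K` over positive indices. -/
theorem sq_sum_norm_le_of_sum_sq_le {a : ℕ → ℂ} {K : ℝ}
    (h : ∀ s : Finset ℕ, ∑ n ∈ s, ((n : ℝ) * ‖a n‖) ^ 2 ≤ K ^ 2) (N : ℕ) :
    (∑ n ∈ Finset.Ioo 0 N, ‖a n‖) ^ 2 ≤ 2 * K ^ 2 := by
  have h1 := Finset.sum_mul_sq_le_sq_mul_sq (Finset.Ioo 0 N) (fun n : ℕ => ((n : ℝ))⁻¹)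
    (fun n => (n : ℝ) * ‖a n‖)
  have h2 : ∑ n ∈ Finset.Ioo 0 N, ((n : ℝ))⁻¹ * ((n : ℝ) * ‖a n‖)
      = ∑ n ∈ Finset.Ioo 0 N, ‖a n‖ := by
    refine Finset.sum_congr rfl fun n hn => ?_
    have : (n : ℝ) ≠ 0 := by exact_mod_cast (Finset.mem_Ioo.mp hn).1.ne'
    field_simp
  have h3 : ∑ n ∈ Finset.Ioo 0 N, ((n : ℝ)⁻¹) ^ 2 ≤ 2 := by
    simpa using sum_Ioo_inv_sq_le (α := ℝ) 0 N
  rw [h2] at h1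
  refine h1.trans ?_
  gcongr
  exact h _

theorem mainTheorem9 (α₁ α₂ α₃ C D m k : ℝ)
    (hα₁ : 0 < α₁) (hα₂ : 0 < α₂) (hα₃ : 0 < α₃)
    (hD : -1 < D) (hDC : D < C) (hC : C ≤ 1)
    (hm : 2 ≤ m) (hmk : m ≤ k)
    (hcond : Real.exp 1 * (1 + |D|) * (C - D) ≤
      (α₁ - α₂ - m ^ 2 * α₃ - 3 * m * (k - 1) * α₃) * (1 - D ^ 2))
    (p : ℂ → ℂ) (hp : AnalyticOnNhd ℂ p (Metric.ball 0 1)) (hp0 : p 0 = 1)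
    (hsub : Subordinate
      (fun z => 1 + (α₁ : ℂ) * (z * deriv p z) + (α₂ : ℂ) * (z ^ 2 * iteratedDeriv 2 p z)
        + (α₃ : ℂ) * (z ^ 3 * iteratedDeriv 3 p z))
      (fun z => (1 + (C : ℂ) * z) / (1 + (D : ℂ) * z))) :
    Subordinate p Complex.exp := by
  have hD1 : |D| < 1 := abs_lt.mpr ⟨hD, hDC.trans_le hC⟩
  set M : ℝ := (C - D) / (1 - |D|) with hMdef
  have hM0 : 0 < M := div_pos (by linarith) (by linarith)
  -- The terms subtracted from `α₁` in `hcond` are nonnegative; dropping them and cancelling `1 +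
  -- |D|` leaves this.
  have hMα : Real.exp 1 * M ≤ α₁ := by
    have h1 : 1 - D ^ 2 = (1 + |D|) * (1 - |D|) := by rw [← sq_abs D]; ring
    have h2 : α₁ - α₂ - m ^ 2 * α₃ - 3 * m * (k - 1) * α₃ ≤ α₁ := by
      have : 0 ≤ 3 * m * (k - 1) * α₃ :=
        mul_nonneg (mul_nonneg (by linarith) (by linarith)) hα₃.le
      have : 0 ≤ m ^ 2 * α₃ := by positivity
      linarith
    have hpos : 0 < 1 + |D| := by positivity
    have h3 : (1 + |D|) * (Real.exp 1 * (C - D)) ≤ (1 + |D|) * (α₁ * (1 - |D|)) := by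
      calc _ = Real.exp 1 * (1 + |D|) * (C - D) := by ring
        _ ≤ _ := hcond
        _ ≤ α₁ * (1 - D ^ 2) :=
          mul_le_mul_of_nonneg_right h2 (by rw [h1]; exact mul_nonneg hpos.le (by linarith))
        _ = _ := by rw [h1]; ring
    have h4 := le_of_mul_le_mul_left h3 hpos
    rw [hMdef, ← mul_div_assoc, div_le_iff₀ (by linarith)]
    exact h4
  obtain ⟨w, ⟨-, -, hw⟩, hwp⟩ := hsub
  set a : ℕ → ℂ := fun n => iteratedDeriv n p 0 / n.factorial with ha
  set l : ℕ → ℝ := fun n => α₁ * n.descFactorial 1 + α₂ * n.descFactorial 2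
    + α₃ * n.descFactorial 3 with hl
  have hbessel := sum_norm_sq_coeff_le_of_norm_le (c := fun n => (l n : ℂ) * a n) (M := M)
    (h := fun z => (α₁ : ℂ) * (z ^ 1 * iteratedDeriv 1 p z)
      + (α₂ : ℂ) * (z ^ 2 * iteratedDeriv 2 p z) + (α₃ : ℂ) * (z ^ 3 * iteratedDeriv 3 p z))
    (fun z hz => by
      have h1 := (((hasSum_pow_mul_iteratedDeriv hp 1 hz).mul_left (α₁ : ℂ)).add
        ((hasSum_pow_mul_iteratedDeriv hp 2 hz).mul_left (α₂ : ℂ))).add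
        ((hasSum_pow_mul_iteratedDeriv hp 3 hz).mul_left (α₃ : ℂ))
      convert! h1 using 1
      funext n
      simp only [hl, ha]
      push_cast
      ring)
    (fun z hz => by
      have h1 := norm_janowski_sub_one_le (w := w z) hD1 hDC
        ((hw z hz).trans (mem_ball_zero_iff.mp hz).le)
      have h2 := hwp z hz
      beta_reduce at h2
      rw [← h2] at h1
      convert h1 using 2
      simp only [iteratedDeriv_one, pow_one]
      ring)
  have hla : ∀ s : Finset ℕ, ∑ n ∈ s, ((n : ℝ) * ‖a n‖) ^ 2 ≤ (M / α₁) ^ 2 := by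
    intro s
    rw [div_pow, le_div_iff₀ (by positivity), Finset.sum_mul]
    refine le_trans (Finset.sum_le_sum fun n _ => ?_) (hbessel s)
    rw [← mul_pow, norm_mul, Complex.norm_real]
    refine pow_le_pow_left₀ (by positivity) ?_ 2
    have h1 : α₁ * n ≤ l n := by
      simp only [hl, Nat.descFactorial_one]
      have : 0 ≤ α₂ * n.descFactorial 2 := by positivity
      have : 0 ≤ α₃ * n.descFactorial 3 := by positivity
      linarith
    calc (n : ℝ) * ‖a n‖ * α₁ = α₁ * n * ‖a n‖ := by ring
      _ ≤ ‖l n‖ * ‖a n‖ := by gcongr; exact h1.trans (le_abs_self _)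
  -- `53 / 100` is a rational just above `√2 / e ≈ 0.5203`.
  have hK : 2 * (M / α₁) ^ 2 ≤ (53 / 100) ^ 2 := by
    have he := Real.exp_one_gt_d9
    have h1 : M / α₁ ≤ 1 / 2.7182 := by
      rw [div_le_div_iff₀ hα₁ (by norm_num)]
      nlinarith
    calc 2 * (M / α₁) ^ 2 ≤ 2 * (1 / 2.7182) ^ 2 := by gcongr
      _ ≤ _ := by norm_num
  refine subordinate_exp_of_norm_sub_one_le hp hp0 fun z hz => ?_
  have hsum := (hasSum_pow_mul_iteratedDeriv hp 0 hz).tendsto_sum_nat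
  simp only [pow_zero, one_mul, Nat.descFactorial_zero, Nat.cast_one, iteratedDeriv_zero] at hsum
  refine le_of_tendsto ((hsum.sub_const 1).norm) ?_
  filter_upwards [Filter.eventually_gt_atTop 0] with N hN
  have hsplit : ∑ n ∈ Finset.range N, iteratedDeriv n p 0 / n.factorial * z ^ n - 1
      = ∑ n ∈ Finset.Ioo 0 N, a n * z ^ n := by
    have : Finset.range N = insert 0 (Finset.Ioo 0 N) := by
      ext n; simp; omega
    rw [this, Finset.sum_insert (by simp)]
    simp [hp0, ha]
  rw [hsplit]
  have h1 : ‖∑ n ∈ Finset.Ioo 0 N, a n * z ^ n‖ ≤ ∑ n ∈ Finset.Ioo 0 N, ‖a n‖ := by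
    refine norm_sum_le_of_le _ fun n _ => ?_
    rw [norm_mul, norm_pow]
    exact mul_le_of_le_one_right (norm_nonneg _)
      (pow_le_one₀ (norm_nonneg _) (mem_ball_zero_iff.mp hz).le)
  exact h1.trans (abs_le_of_sq_le_sq' ((sq_sum_norm_le_of_sum_sq_le hla N).trans hK) (by norm_num)).2
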